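/- Let $M\ge 1$ and $[M]=\{1,\dots,M\}$. Consider an $M$-user discrete memoryless multiple-access channel with finite input alphabets $\mathcal X_1,\dots,\mathcal X_M$, finite output alphabet $\mathcal Y$ and transition probabilities $W(y\mid x_1,\dots,x_M)$. Let $X_1,\dots,X_M$ be independent inputs with laws $P_{X_1},\dots,P_{X_M}$, and let $Y$ be the corresponding output. For $R\in\mathbb R^M$ and $\mathcal S\subseteq[M]$ write $R(\mathcal S)=\sum_{i\in\mathcal S}R_i$, $X_{\mathcal S}=(X_i)_{i\in\mathcal S}$, $\mathcal S^c=[M]\setminus\mathcal S$, and let $$\mathcal R=\{R\in\mathbb R_{\ge 0}^M:\ R(\mathcal S)\le I(X_{\mathcal S};Y\mid X_{\mathcal S^c})\ \text{ for all } \mathcal S\subseteq[M]\}.$$ Assume that $\mathcal R$ is non-degenerated, that is, 1. $I(X_{\mathcal S};Y)>0$ for every non-empty $\mathcal S\subseteq[M]$, and 2. $I(X_{\mathcal S};Y\mid X_{\mathcal A})<I(X_{\mathcal S};Y\mid X_{\mathcal B})$ whenever $\emptyset\ne\mathcal S\subsetneq[M]$, $\mathcal A\subsetneq\mathcal B\subsetneq[M]$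 and $\mathcal S\cap\mathcal B=\emptyset$. A face of $\mathcal R$ is a set of the form $\mathcal R\cap\{R:\sum_i R_ia_i=a_0\}$, where $a\in\mathbb R^M$, $a_0\in\mathbb R$ and the inequality $\sum_i R_ia_i\le a_0$ holds on all of $\mathcal R$; the dimension of a non-empty face is the dimension of its affine hull. The dominant facet is $\{R\in\mathcal R: R([M])=I(X_{[M]};Y)\}$. Then, for every $D\in\{0,1,\dots,M\}$, the number $N_d(M,D)$ of (non-empty) $D$-dimensional faces of $\mathcal R$ that are contained in the dominant facet is finite and equals $$N_d(M,D)=\sum_{j=1}^{M-D}\binom{M-D}{j}(-1)^{M-D-j}j^M=(M-D)!\,S(M,M-D),$$ where $S(M,n)$ denotes the Stirling number of the second kind. -/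

import Mathlib

/-! ### Information measures on a finite probability space -/

open Classical in
/-- `P(U = u)`, where `p` is the probability mass function of a finite sample space. -/
noncomputable def prob {Ω α : Type*} [Fintype Ω] (p : Ω → ℝ) (U : Ω → α) (u : α) : ℝ :=
  ∑ ω, if U ω = u then p ω else 0

/-- Mutual information `I(U; V) = E[log (p(U,V) / (p(U) p(V)))]`, in nats. -/
noncomputable def mutualInfo {Ω α β : Type*} [Fintype Ω] (p : Ω → ℝ)
    (U : Ω → α) (V : Ω → β) : ℝ :=
  ∑ ω, p ω * Real.log
    (prob p (fun ω' => (U ω', V ω')) (U ω, V ω) / (prob p U (U ω) * prob p V (V ω)))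

/-- Conditional mutual information
`I(U; V | Z) = E[log (p(U,V,Z) p(Z) / (p(U,Z) p(V,Z)))]`, in nats. -/
noncomputable def condMutualInfo {Ω α β γ : Type*} [Fintype Ω] (p : Ω → ℝ)
    (U : Ω → α) (V : Ω → β) (Z : Ω → γ) : ℝ :=
  ∑ ω, p ω * Real.log
    ((prob p (fun ω' => (U ω', V ω', Z ω')) (U ω, V ω, Z ω) * prob p Z (Z ω)) /
      (prob p (fun ω' => (U ω', Z ω')) (U ω, Z ω) *
        prob p (fun ω' => (V ω', Z ω')) (V ω, Z ω)))

/-! ### The multiple-access channel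

The users are the elements of `Fin M`. User `i` has the finite input alphabet `X i`, `Y` is the
finite output alphabet, `W x` is the law of the output when the inputs are `x`, and `P i` is the
law of the input of user `i`. -/

namespace MAC

variable {M : ℕ} {X : Fin M → Type*} {Y : Type*}

/-- The joint law of `(X_1, …, X_M, Y)`: independent inputs followed by the channel. -/
noncomputable def joint (P : ∀ i, PMF (X i)) (W : (∀ i, X i) → PMF Y)
    (ω : (∀ i, X i) × Y) : ℝ :=
  (∏ i, (P i (ω.1 i)).toReal) * (W ω.1 ω.2).toReal

/-- The random variable `X_S = (X_i)_{i ∈ S}` (a constant if `S` is empty). -/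
def inputs (S : Finset (Fin M)) (ω : (∀ i, X i) × Y) : (i : S) → X i :=
  fun i => ω.1 i

variable [∀ i, Fintype (X i)] [Fintype Y]

/-- `I(X_S; Y)`. -/
noncomputable def info (P : ∀ i, PMF (X i)) (W : (∀ i, X i) → PMF Y)
    (S : Finset (Fin M)) : ℝ :=
  mutualInfo (joint P W) (inputs S) Prod.snd

/-- `I(X_S; Y | X_A)`. -/
noncomputable def condInfo (P : ∀ i, PMF (X i)) (W : (∀ i, X i) → PMF Y)
    (S A : Finset (Fin M)) : ℝ :=
  condMutualInfo (joint P W) (inputs S) Prod.snd (inputs A)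

/-- The region `{R ∈ ℝ_+^M : R(S) ≤ I(X_S; Y | X_{Sᶜ}) for all S ⊆ [M]}`. -/
def region (P : ∀ i, PMF (X i)) (W : (∀ i, X i) → PMF Y) : Set (Fin M → ℝ) :=
  {R | (∀ i, 0 ≤ R i) ∧ ∀ S : Finset (Fin M), ∑ i ∈ S, R i ≤ condInfo P W S Sᶜ}

/-- The front facet `F_S = {R ∈ region : R(S) = I(X_S; Y | X_{Sᶜ})}`. -/
def frontFacet (P : ∀ i, PMF (X i)) (W : (∀ i, X i) → PMF Y) (S : Finset (Fin M)) :
    Set (Fin M → ℝ) :=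
  region P W ∩ {R | ∑ i ∈ S, R i = condInfo P W S Sᶜ}

/-- The dominant facet `F_{[M]}`. -/
def dominantFacet (P : ∀ i, PMF (X i)) (W : (∀ i, X i) → PMF Y) : Set (Fin M → ℝ) :=
  frontFacet P W Finset.univ

/-- The region is non-degenerated: each input carries information, and all inputs interfere
with one another. -/
structure NonDegenerated (P : ∀ i, PMF (X i)) (W : (∀ i, X i) → PMF Y) : Prop where
  info_pos : ∀ S : Finset (Fin M), S.Nonempty → 0 < info P W S
  condInfo_lt : ∀ S A B : Finset (Fin M), S.Nonempty → S ⊂ Finset.univ → A ⊂ B →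
    B ⊂ Finset.univ → Disjoint S B → condInfo P W S A < condInfo P W S B

end MAC

/-! ### Faces -/

/-- `F` is a face of `Q ⊆ ℝ^M`: the set of points of `Q` at which some inequality
`∑ i, R i * a i ≤ a₀` that is valid on `Q` holds with equality. -/
def IsFace {M : ℕ} (Q F : Set (Fin M → ℝ)) : Prop :=
  ∃ (a : Fin M → ℝ) (a₀ : ℝ), (∀ R ∈ Q, ∑ i, R i * a i ≤ a₀) ∧
    F = Q ∩ {R | ∑ i, R i * a i = a₀}

/-- `F` has dimension `D`, i.e. `F` is non-empty and its affine hull has dimension `D`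
(the empty face has no dimension in `ℕ`). -/
def HasDim {M : ℕ} (F : Set (Fin M → ℝ)) (D : ℕ) : Prop :=
  F.Nonempty ∧ Module.finrank ℝ (affineSpan ℝ F).direction = D

/-- The set of the `D`-dimensional faces of the region that lie in the dominant facet. -/
def MAC.dominantFaces {M : ℕ} {X : Fin M → Type*} {Y : Type*} [∀ i, Fintype (X i)] [Fintype Y]
    (P : ∀ i, PMF (X i)) (W : (∀ i, X i) → PMF Y) (D : ℕ) : Set (Set (Fin M → ℝ)) :=
  {F | IsFace (MAC.region P W) F ∧ F ⊆ MAC.dominantFacet P W ∧ HasDim F D}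

/-! With `g A = -H(Y | X_A)`, the chain rule gives `f S = I(X_S; Y | X_Sᶜ) = g [M] - g Sᶜ`, and
non-degeneracy makes `f` a strict polymatroid (`NonDegenerated.isStrict`). Write the normal vector
of a face in the dominant facet as a combination of the indicators of its upper level sets. The face
is then the locus where this chain of sets is tight, so it is `chainFace f b` for an ordered
partition `b` of the users (`exists_eq_chainFace`). Every ordered partition arises
(`isFace_chainFace`). By strictness, the sets tight at a greedy vertex are exactly the lower sets of
its order (`sum_greedy`). Averaging such vertices gives a point of `chainFace f b` with positive
coordinates where no non-empty set outside the chain is tight (`exists_mem_chainFace`). Hence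
distinct partitions give distinct faces, and `n` blocks give dimension `M - n`. The count is
therefore that of surjections `Fin M → Fin (M - D)`. -/

/-! ### Counting surjections -/

open Finset in
/-- The number of surjections `Fin m → Fin n`, by inclusion and exclusion. -/
theorem card_surjective_eq_sum (m n : ℕ) :
    (({b : Fin m → Fin n | Function.Surjective b}.ncard : ℕ) : ℤ) =
      ∑ j ∈ range (n + 1), (n.choose j : ℤ) * (-1) ^ (n - j) * (j : ℤ) ^ m := by
  classical
  set A : Fin n → Finset (Fin m → Fin n) := fun k => univ.filter fun b => ∀ i, b i ≠ k with hA
  have h1 : {b : Fin m → Fin n | Function.Surjective b}.ncard =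
      #((univ : Finset (Fin n)).inf fun k => (A k)ᶜ) := by
    rw [← Set.ncard_coe_finset]
    congr 1
    ext b
    simp [hA, Finset.mem_inf, Function.Surjective]
  have h2 : ∀ t : Finset (Fin n), #(t.inf A) = (n - #t) ^ m := by
    intro t
    have : t.inf A = Fintype.piFinset fun _ : Fin m => tᶜ := by
      ext b
      simp only [Finset.mem_inf, hA, mem_filter, mem_univ, true_and, Fintype.mem_piFinset,
        mem_compl]
      exact ⟨fun h i hi => h _ hi i rfl, fun h k hk i hi => h i (hi ▸ hk)⟩
    rw [this, Fintype.card_piFinset_const, card_compl, Fintype.card_fin]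
  rw [h1, inclusion_exclusion_card_inf_compl]
  simp only [h2]
  rw [sum_powerset_apply_card (fun c => (-1 : ℤ) ^ c * (((n - c) ^ m : ℕ) : ℤ)), card_univ,
    Fintype.card_fin, ← sum_range_reflect]
  refine sum_congr rfl fun j hj => ?_
  have hj' : j ≤ n := by simpa [Nat.lt_succ_iff] using hj
  have e : n + 1 - 1 - j = n - j := by omega
  rw [e, Nat.choose_symm hj', Nat.sub_sub_self hj']
  simp [mul_assoc]

-- Both sides satisfy `a (m+1) (n+1) = (n+1) * (a m (n+1) + a m n)`; on the right this holds term by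
-- term, by Pascal's rule and absorption. The sign `(-1) ^ (n + j)` avoids truncated subtraction.
open Finset in
theorem factorial_mul_stirlingSecond_eq_sum (m n : ℕ) :
    ((n.factorial * Nat.stirlingSecond m n : ℕ) : ℤ) =
      ∑ j ∈ range (n + 1), (n.choose j : ℤ) * (-1) ^ (n + j) * (j : ℤ) ^ m := by
  induction m generalizing n with
  | zero =>
    have h : ∑ j ∈ range (n + 1), (n.choose j : ℤ) * (-1) ^ (n + j) * (j : ℤ) ^ 0 =
        (-1) ^ n * ∑ j ∈ range (n + 1), (-1 : ℤ) ^ j * (n.choose j : ℤ) := by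
      rw [mul_sum]
      exact sum_congr rfl fun j _ => by ring
    rw [h, Int.alternating_sum_range_choose]
    cases n <;> simp
  | succ m ih =>
    cases n with
    | zero => simp
    | succ n =>
      have e1 : ((((n + 1).factorial * Nat.stirlingSecond (m + 1) (n + 1) : ℕ)) : ℤ) =
          (n + 1) * ((((n + 1).factorial * Nat.stirlingSecond m (n + 1) : ℕ) : ℤ) +
            ((n.factorial * Nat.stirlingSecond m n : ℕ) : ℤ)) := by
        rw [Nat.stirlingSecond_succ_succ, Nat.factorial_succ]
        push_cast
        ring
      have e2 : ∑ j ∈ range (n + 1), (n.choose j : ℤ) * (-1) ^ (n + j) * (j : ℤ) ^ m =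
          ∑ j ∈ range (n + 1 + 1), (n.choose j : ℤ) * (-1) ^ (n + j) * (j : ℤ) ^ m := by
        rw [sum_range_succ _ (n + 1)]
        simp
      rw [e1, ih, ih, e2, ← sum_add_distrib, mul_sum]
      refine sum_congr rfl fun j _ => ?_
      cases j with
      | zero => simp [pow_succ]
      | succ j =>
        have h1 : ((n + 1 : ℕ) : ℤ) * (n.choose j : ℤ) =
            ((n + 1).choose (j + 1) : ℤ) * ((j + 1 : ℕ) : ℤ) := by
          exact_mod_cast Nat.add_one_mul_choose_eq n j
        have h2 : ((n + 1).choose (j + 1) : ℤ) = n.choose j + n.choose (j + 1) := by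
          exact_mod_cast Nat.choose_succ_succ n j
        have h3 : ((n : ℤ) + 1) * ((n + 1).choose (j + 1) - n.choose (j + 1)) =
            ((n + 1).choose (j + 1) : ℤ) * ((j + 1 : ℕ) : ℤ) := by
          rw [← h1, h2]; push_cast; ring
        rw [pow_succ _ m]
        linear_combination -(-1 : ℤ) * (-1) ^ (n + 1 + (j + 1)) * ((j + 1 : ℕ) : ℤ) ^ m * h3

open Finset in
theorem ncard_surjective_fin {m : ℕ} (hm : 1 ≤ m) (n : ℕ) :
    (({b : Fin m → Fin n | Function.Surjective b}.ncard : ℕ) : ℤ) =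
        ∑ j ∈ Icc 1 n, (n.choose j : ℤ) * (-1) ^ (n - j) * (j : ℤ) ^ m ∧
      {b : Fin m → Fin n | Function.Surjective b}.ncard =
        n.factorial * Nat.stirlingSecond m n := by
  constructor
  · rw [card_surjective_eq_sum]
    symm
    refine sum_subset (fun j hj => ?_) fun j hj hj' => ?_
    · simp only [mem_Icc, mem_range] at *
      omega
    -- The only extra term is `j = 0`, which vanishes because `m ≥ 1`.
    · have : j = 0 := by
        simp only [mem_Icc, mem_range] at *
        omega
      simp [this, zero_pow (by omega : m ≠ 0)]
  · zify
    rw [card_surjective_eq_sum, ← Nat.cast_mul, factorial_mul_stirlingSecond_eq_sum]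
    refine sum_congr rfl fun j hj => ?_
    have hj' : j ≤ n := by simpa [Nat.lt_succ_iff] using hj
    rw [show n + j = n - j + 2 * j by omega, pow_add, pow_mul]
    simp

/-! ### Conditional information as differences -/

theorem prob_congr {Ω α β : Type*} [Fintype Ω] {p : Ω → ℝ} {U : Ω → α} {V : Ω → β} {u : α} {v : β}
    (h : ∀ ω, U ω = u ↔ V ω = v) : prob p U u = prob p V v := by
  classical
  unfold prob
  exact Finset.sum_congr rfl fun ω _ => if_congr (h ω) rfl rfl

theorem prob_pos {Ω α : Type*} [Fintype Ω] {p : Ω → ℝ} (hp : ∀ ω, 0 ≤ p ω) (U : Ω → α) {ω : Ω}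
    (hω : 0 < p ω) : 0 < prob p U (U ω) := by
  classical
  unfold prob
  refine Finset.sum_pos' (fun ω' _ => ?_) ⟨ω, Finset.mem_univ _, by simpa using hω⟩
  split_ifs <;> simp [hp]

namespace MAC

variable {M : ℕ} {X : Fin M → Type*} {Y : Type*}

theorem inputs_eq_iff (S : Finset (Fin M)) (ω ω' : (∀ i, X i) × Y) :
    inputs S ω = inputs S ω' ↔ ∀ i ∈ S, ω.1 i = ω'.1 i := by
  simp [inputs, funext_iff]

theorem inputs_union_eq_iff (S T : Finset (Fin M)) (ω ω' : (∀ i, X i) × Y) :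
    inputs (S ∪ T) ω = inputs (S ∪ T) ω' ↔ inputs S ω = inputs S ω' ∧ inputs T ω = inputs T ω' := by
  simp only [inputs_eq_iff, Finset.mem_union, or_imp, forall_and]

theorem joint_nonneg (P : ∀ i, PMF (X i)) (W : (∀ i, X i) → PMF Y) (ω : (∀ i, X i) × Y) :
    0 ≤ joint P W ω :=
  mul_nonneg (Finset.prod_nonneg fun _ _ => ENNReal.toReal_nonneg) ENNReal.toReal_nonneg

theorem _root_.PMF.sum_toReal {α : Type*} [Fintype α] (p : PMF α) : ∑ a, (p a).toReal = 1 := by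
  rw [← ENNReal.toReal_sum fun a _ => p.apply_ne_top a, ← tsum_fintype (L := .unconditional _),
    p.tsum_coe, ENNReal.toReal_one]

variable [∀ i, Fintype (X i)] [Fintype Y]

theorem sum_joint (P : ∀ i, PMF (X i)) (W : (∀ i, X i) → PMF Y) : ∑ ω, joint P W ω = 1 := by
  classical
  rw [Fintype.sum_prod_type]
  simp only [joint, ← Finset.mul_sum, PMF.sum_toReal, mul_one]
  rw [← Fintype.prod_sum fun i a => (P i a).toReal]
  simp [PMF.sum_toReal]

/-- `-H(Y | X_A) = E[log p(Y | X_A)]`. -/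
noncomputable def negCondEntropy (P : ∀ i, PMF (X i)) (W : (∀ i, X i) → PMF Y)
    (A : Finset (Fin M)) : ℝ :=
  ∑ ω, joint P W ω * Real.log
    (prob (joint P W) (fun ω' => (ω'.2, inputs A ω')) (ω.2, inputs A ω) /
      prob (joint P W) (inputs A) (inputs A ω))

theorem condInfo_eq_sub (P : ∀ i, PMF (X i)) (W : (∀ i, X i) → PMF Y) (S A : Finset (Fin M)) :
    condInfo P W S A = negCondEntropy P W (S ∪ A) - negCondEntropy P W A := by
  unfold condInfo condMutualInfo negCondEntropy
  rw [← Finset.sum_sub_distrib]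
  refine Finset.sum_congr rfl fun ω _ => ?_
  -- Outcomes of mass zero contribute nothing; at the others all marginals are positive and the
  -- logarithm splits.
  rcases (joint_nonneg P W ω).eq_or_lt' with h | h
  · simp [h]
  have hp := joint_nonneg P W
  have e1 : prob (joint P W) (fun ω' => (inputs S ω', ω'.2, inputs A ω'))
      (inputs S ω, ω.2, inputs A ω) =
      prob (joint P W) (fun ω' => (ω'.2, inputs (S ∪ A) ω')) (ω.2, inputs (S ∪ A) ω) :=
    prob_congr fun ω' => by simp only [Prod.mk.injEq, inputs_union_eq_iff]; tauto
  have e2 : prob (joint P W) (fun ω' => (inputs S ω', inputs A ω')) (inputs S ω, inputs A ω) =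
      prob (joint P W) (inputs (S ∪ A)) (inputs (S ∪ A) ω) :=
    prob_congr fun ω' => by simp only [Prod.mk.injEq, inputs_union_eq_iff]
  rw [e1, e2]
  have h1 := (prob_pos hp (fun ω' => (ω'.2, inputs (S ∪ A) ω')) h).ne'
  have h2 := (prob_pos hp (inputs (S ∪ A)) h).ne'
  have h3 := (prob_pos hp (fun ω' => (ω'.2, inputs A ω')) h).ne'
  have h4 := (prob_pos hp (inputs A) h).ne'
  rw [Real.log_div (mul_ne_zero h1 h4) (mul_ne_zero h2 h3), Real.log_mul h1 h4,
    Real.log_mul h2 h3, Real.log_div h1 h2, Real.log_div h3 h4]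
  ring

theorem info_eq_sub (P : ∀ i, PMF (X i)) (W : (∀ i, X i) → PMF Y) (S : Finset (Fin M)) :
    info P W S = negCondEntropy P W S - negCondEntropy P W ∅ := by
  unfold info mutualInfo negCondEntropy
  rw [← Finset.sum_sub_distrib]
  refine Finset.sum_congr rfl fun ω _ => ?_
  rcases (joint_nonneg P W ω).eq_or_lt' with h | h
  · simp [h]
  have hp := joint_nonneg P W
  have e1 : prob (joint P W) (fun ω' => (inputs S ω', ω'.2)) (inputs S ω, ω.2) =
      prob (joint P W) (fun ω' => (ω'.2, inputs S ω')) (ω.2, inputs S ω) :=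
    prob_congr fun ω' => by simp only [Prod.mk.injEq]; tauto
  have e2 : prob (joint P W) (fun ω' => (ω'.2, inputs ∅ ω')) (ω.2, inputs ∅ ω) =
      prob (joint P W) Prod.snd ω.2 :=
    prob_congr fun ω' => by simp [inputs_eq_iff]
  have e3 : prob (joint P W) (inputs ∅) (inputs ∅ ω) = 1 := by
    simp [prob, inputs_eq_iff, sum_joint]
  rw [e1, e2, e3, div_one]
  have h1 := (prob_pos hp (fun ω' => (ω'.2, inputs S ω')) h).ne'
  have h2 := (prob_pos hp (inputs S) h).ne'
  have h3 := (prob_pos hp Prod.snd h).ne'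
  rw [Real.log_div h1 (mul_ne_zero h2 h3), Real.log_mul h2 h3, Real.log_div h1 h2]
  ring

end MAC

/-! ### Strict polymatroids and the faces of their base polytopes -/

namespace Polymatroid

open Finset

variable {M n : ℕ} {f : Finset (Fin M) → ℝ}

/-- The polyhedron `{R ≥ 0 : R(S) ≤ f(S) for all S}`. -/
def polytope (f : Finset (Fin M) → ℝ) : Set (Fin M → ℝ) :=
  {R | (∀ i, 0 ≤ R i) ∧ ∀ S : Finset (Fin M), ∑ i ∈ S, R i ≤ f S}

/-- A set function that vanishes at `∅`, is strictly submodular on incomparable pairs, and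
strictly increases in the last step to the full set. -/
structure IsStrict (f : Finset (Fin M) → ℝ) : Prop where
  map_empty : f ∅ = 0
  submod : ∀ S T : Finset (Fin M), ¬ S ⊆ T → ¬ T ⊆ S → f (S ∪ T) + f (S ∩ T) < f S + f T
  erase_lt : ∀ i, f (univ.erase i) < f univ

/-- The part of the polytope where the constraints of the sets `{b ≤ k}` are tight. -/
def chainFace (f : Finset (Fin M) → ℝ) (b : Fin M → Fin n) : Set (Fin M → ℝ) :=
  {R | R ∈ polytope f ∧ ∀ k, ∑ i with b i ≤ k, R i = f {i | b i ≤ k}}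

/-- The vertex that the greedy algorithm finds for the order of the users given by `w`. -/
def greedy {ι : Type*} [LinearOrder ι] (f : Finset (Fin M) → ℝ) (w : Fin M → ι) : Fin M → ℝ :=
  fun i => f {j | w j ≤ w i} - f {j | w j < w i}

theorem filter_le_eq_insert {ι : Type*} [LinearOrder ι] {w : Fin M → ι}
    (hw : Function.Injective w) (i : Fin M) :
    univ.filter (fun j => w j ≤ w i) = insert i (univ.filter fun j => w j < w i) := by
  ext j
  simp only [mem_filter, mem_univ, true_and, mem_insert, le_iff_lt_or_eq, hw.eq_iff]
  tauto

/-! ### Greedy vertices and their tight sets. -/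

namespace IsStrict

theorem submod_le (hf : IsStrict f) (S T : Finset (Fin M)) :
    f (S ∪ T) + f (S ∩ T) ≤ f S + f T := by
  by_cases h : S ⊆ T
  · rw [union_eq_right.2 h, inter_eq_left.2 h, add_comm]
  by_cases h' : T ⊆ S
  · rw [union_eq_left.2 h', inter_eq_right.2 h']
  exact (hf.submod S T h h').le

/-- Submodularity makes the increment of `i` at `S` at least its increment in the last step to the
full set. -/
theorem lt_insert (hf : IsStrict f) {S : Finset (Fin M)} {i : Fin M} (hi : i ∉ S) :
    f S < f (insert i S) := by
  have h := hf.submod_le (insert i S) (univ.erase i)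
  have h1 : insert i S ∪ univ.erase i = univ := by
    ext j; by_cases hj : j = i <;> simp [hj]
  have h2 : insert i S ∩ univ.erase i = S := by
    ext j
    by_cases hj : j = i
    · simp [hj, hi]
    · simp [hj]
  rw [h1, h2] at h
  linarith [hf.erase_lt i]

variable {ι : Type*} [LinearOrder ι] {w : Fin M → ι}

theorem greedy_pos (hf : IsStrict f) (hw : Function.Injective w) (i : Fin M) :
    0 < greedy f w i := by
  unfold greedy
  rw [filter_le_eq_insert hw]
  exact sub_pos.2 (hf.lt_insert (by simp))

/-- At a greedy vertex, exactly the constraints of the lower sets are tight. -/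
theorem sum_greedy (hf : IsStrict f) (hw : Function.Injective w) (S : Finset (Fin M)) :
    ∑ i ∈ S, greedy f w i ≤ f S ∧
      (∑ i ∈ S, greedy f w i = f S ↔ ∀ i ∈ S, ∀ j, w j ≤ w i → j ∈ S) := by
  induction S using Finset.induction_on_max_value w with
  | empty => simp [hf.map_empty]
  | insert a s ha hs ih =>
    obtain ⟨ih1, ih2⟩ := ih
    rw [sum_insert ha]
    unfold greedy at ih1 ih2 ⊢
    rw [filter_le_eq_insert hw]
    set L : Finset (Fin M) := {j | w j < w a} with hL
    have hsL : s ⊆ L := fun x hx => by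
      have : x ≠ a := fun h => ha (h ▸ hx)
      simpa [hL] using lt_of_le_of_ne (hs x hx) (hw.ne this)
    have haL : a ∉ L := by simp [hL]
    have hu : insert a s ∪ L = insert a L := by
      rw [insert_union, union_eq_right.2 hsL]
    have hi : insert a s ∩ L = s := by
      rw [insert_inter_of_notMem haL, inter_eq_left.2 hsL]
    -- Since `a` is maximal, `s` lies among its strict predecessors `L`, and submodularity bounds
    -- the greedy value at `a` by `f (insert a s) - f s`. As `a ∉ L`, strictness allows equality
    -- only if `L ⊆ insert a s`, that is `L = s`.
    have hsub := hf.submod_le (insert a s) L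
    rw [hu, hi] at hsub
    refine ⟨by linarith, fun h => ?_, fun h => ?_⟩
    · by_cases hLs : L ⊆ insert a s
      · have hLs' : L = s := by
          refine subset_antisymm (fun x hx => ?_) hsL
          rcases mem_insert.1 (hLs hx) with rfl | h
          · exact absurd hx haL
          · exact h
        rw [← hLs', hL, ← filter_le_eq_insert hw]
        intro i hi j hj
        simp only [mem_filter, mem_univ, true_and] at hi ⊢
        exact hj.trans hi
      · have := hf.submod (insert a s) L (fun h => haL (h (mem_insert_self _ _))) hLs
        rw [hu, hi] at this
        linarith
    · have hLs : L = s := by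
        refine subset_antisymm (fun x hx => ?_) hsL
        have hx' : w x < w a := by simpa [hL] using hx
        rcases mem_insert.1 (h a (mem_insert_self _ _) x hx'.le) with rfl | h
        · exact absurd hx haL
        · exact h
      have : ∀ i ∈ s, ∀ j, w j ≤ w i → j ∈ s := by
        rw [← hLs, hL]
        intro i hi j hj
        simp only [mem_filter, mem_univ, true_and] at hi ⊢
        exact hj.trans_lt hi
      rw [ih2.2 this, hLs]
      ring

theorem greedy_mem_polytope (hf : IsStrict f) (hw : Function.Injective w) :
    greedy f w ∈ polytope f :=
  ⟨fun i => (hf.greedy_pos hw i).le, fun S => (hf.sum_greedy hw S).1⟩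

end IsStrict

/-- The lexicographic order that refines `b` and puts `i` last in its block. -/
def refine (b : Fin M → Fin n) (i : Fin M) (j : Fin M) : Fin n ×ₗ ℕ ×ₗ Fin M :=
  toLex (b j, toLex (if j = i then 1 else 0, j))

theorem refine_injective (b : Fin M → Fin n) (i : Fin M) : Function.Injective (refine b i) := by
  intro j k h
  simp only [refine, EmbeddingLike.apply_eq_iff_eq, Prod.mk.injEq] at h
  exact h.2.2

theorem le_of_refine_le {b : Fin M → Fin n} {i j k : Fin M} (h : refine b i j ≤ refine b i k) :
    b j ≤ b k := by
  rcases Prod.Lex.toLex_le_toLex.1 h with h | h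
  · exact h.le
  · exact h.1.le

theorem refine_le {b : Fin M → Fin n} {i j : Fin M} (h : b j ≤ b i) (hij : j ≠ i) :
    refine b i j ≤ refine b i i := by
  refine Prod.Lex.toLex_le_toLex.2 ?_
  rcases h.lt_or_eq with h | h
  · exact Or.inl h
  · exact Or.inr ⟨h, Prod.Lex.toLex_le_toLex.2 (Or.inl (by simp [hij]))⟩

theorem IsStrict.greedy_refine_mem_chainFace (hf : IsStrict f) (b : Fin M → Fin n) (i : Fin M) :
    greedy f (refine b i) ∈ chainFace f b := by
  refine ⟨hf.greedy_mem_polytope (refine_injective b i), fun k => ?_⟩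
  refine (hf.sum_greedy (refine_injective b i) _).2.2 fun l hl j hj => ?_
  simp only [mem_filter, mem_univ, true_and] at hl ⊢
  exact (le_of_refine_le hj).trans hl

/-- A set that separates no user from a user of a lower or the same block is some `{b ≤ k}`. -/
theorem exists_eq_filter_le {b : Fin M → Fin n} {S : Finset (Fin M)} (hS : S.Nonempty)
    (h : ∀ i ∈ S, ∀ j, b j ≤ b i → j ∈ S) : ∃ k, S = univ.filter fun i => b i ≤ k := by
  obtain ⟨i, hi, hmax⟩ := S.exists_max_image b hS
  refine ⟨b i, ?_⟩
  ext j
  simp only [mem_filter, mem_univ, true_and]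
  exact ⟨fun hj => hmax j hj, fun hj => h i hi j hj⟩

theorem IsStrict.exists_mem_chainFace_lt (hf : IsStrict f) (hM : 1 ≤ M) (b : Fin M → Fin n)
    (S : Finset (Fin M)) : ∃ R ∈ chainFace f b, (∀ i, 0 < R i) ∧
      (S.Nonempty → ∑ i ∈ S, R i = f S → ∃ k, S = univ.filter fun i => b i ≤ k) := by
  by_cases h : ∀ i ∈ S, ∀ j, b j ≤ b i → j ∈ S
  · exact ⟨_, hf.greedy_refine_mem_chainFace b ⟨0, hM⟩, hf.greedy_pos (refine_injective _ _),
      fun hS _ => exists_eq_filter_le hS h⟩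
  · push Not at h
    -- With `i` last in its block, `j` precedes `i`, so `S` is not a lower set of the order and its
    -- constraint is slack.
    obtain ⟨i, hi, j, hij, hj⟩ := h
    refine ⟨_, hf.greedy_refine_mem_chainFace b i, hf.greedy_pos (refine_injective _ _),
      fun _ hS => ?_⟩
    exact absurd ((hf.sum_greedy (refine_injective b i) S).2.1 hS i hi j
      (refine_le hij fun h => hj (h ▸ hi))) hj

/-- A relatively interior point of a face: no constraint is tight that need not be. -/
theorem IsStrict.exists_mem_chainFace (hf : IsStrict f) (hM : 1 ≤ M) (b : Fin M → Fin n) :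
    ∃ R ∈ chainFace f b, (∀ i, 0 < R i) ∧
      ∀ S : Finset (Fin M), S.Nonempty → ∑ i ∈ S, R i = f S →
        ∃ k, S = univ.filter fun i => b i ≤ k := by
  -- Average the vertices chosen for all sets `S`: a constraint tight at the average is tight at
  -- each of them, in particular at the vertex chosen for that very set.
  choose v hv hpos htight using hf.exists_mem_chainFace_lt hM b
  set N : ℝ := (Fintype.card (Finset (Fin M)) : ℝ) with hN
  have hN0 : 0 < N := by
    rw [hN]
    exact_mod_cast Fintype.card_pos
  have hsum : ∀ T : Finset (Fin M), ∑ i ∈ T, N⁻¹ * ∑ S, v S i = N⁻¹ * ∑ S, ∑ i ∈ T, v S i := by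
    intro T
    rw [← mul_sum, sum_comm]
  have hconst : ∀ c : ℝ, N⁻¹ * ∑ _S : Finset (Fin M), c = c := by
    intro c
    rw [sum_const, card_univ, nsmul_eq_mul, ← hN, inv_mul_cancel_left₀ hN0.ne']
  have hp : ∀ i, 0 < N⁻¹ * ∑ S, v S i := fun i =>
    mul_pos (inv_pos.2 hN0) (sum_pos (fun S _ => hpos S i) univ_nonempty)
  refine ⟨fun i => N⁻¹ * ∑ S, v S i, ⟨⟨fun i => (hp i).le, fun T => ?_⟩, fun k => ?_⟩, hp,
    fun T hT hTf => ?_⟩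
  · rw [hsum, ← hconst (f T)]
    exact mul_le_mul_of_nonneg_left (sum_le_sum fun S _ => (hv S).1.2 T) (inv_pos.2 hN0).le
  · rw [hsum, ← hconst (f _)]
    exact congrArg _ (sum_congr rfl fun S _ => (hv S).2 k)
  · refine htight T hT ?_
    rw [hsum, ← hconst (f T)] at hTf
    have := mul_left_cancel₀ (inv_pos.2 hN0).ne' hTf
    exact (sum_eq_sum_iff_of_le fun S _ => (hv S).1.2 T).1 this T (mem_univ _)

/-! #### Different partitions give different faces -/

theorem filter_le_strictMono {b : Fin M → Fin n} (hb : Function.Surjective b) :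
    StrictMono fun k => ({i | b i ≤ k} : Finset (Fin M)) := by
  intro k l hkl
  refine (Finset.ssubset_iff_of_subset ?_).2 ?_
  · intro i hi
    simp only [mem_filter, mem_univ, true_and] at hi ⊢
    exact hi.trans hkl.le
  · obtain ⟨i, rfl⟩ := hb l
    exact ⟨i, by simp, by simpa using hkl⟩

theorem filter_le_nonempty {b : Fin M → Fin n} (hb : Function.Surjective b) (k : Fin n) :
    ({i | b i ≤ k} : Finset (Fin M)).Nonempty := by
  obtain ⟨i, rfl⟩ := hb k
  exact ⟨i, by simp⟩

/-- At a relatively interior point of the smaller face, the sets of the chain of `c` are tight,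
hence belong to the chain of `b`. -/
theorem IsStrict.range_subset_of_chainFace_subset (hf : IsStrict f) (hM : 1 ≤ M)
    {b c : Fin M → Fin n} (hc : Function.Surjective c) (h : chainFace f b ⊆ chainFace f c) :
    Set.range (fun k => ({i | c i ≤ k} : Finset (Fin M))) ⊆
      Set.range fun k => ({i | b i ≤ k} : Finset (Fin M)) := by
  obtain ⟨R, hR, -, htight⟩ := hf.exists_mem_chainFace hM b
  rintro _ ⟨k, rfl⟩
  obtain ⟨l, hl⟩ := htight _ (filter_le_nonempty hc k) ((h hR).2 k)
  exact ⟨l, hl.symm⟩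

theorem IsStrict.chainFace_injOn (hf : IsStrict f) (hM : 1 ≤ M) :
    Set.InjOn (chainFace f) {b : Fin M → Fin n | Function.Surjective b} := by
  intro b hb c hc h
  have hr := (hf.range_subset_of_chainFace_subset hM hb h.ge).antisymm
    (hf.range_subset_of_chainFace_subset hM hc h.le)
  -- A strictly increasing enumeration by `Fin n` is determined by its range.
  have he := ((filter_le_strictMono hb).range_inj (filter_le_strictMono hc)).1 hr
  funext i
  have key : ∀ k, b i ≤ k ↔ c i ≤ k := fun k => by
    have := congrArg (fun s : Finset (Fin M) => i ∈ s) (congrFun he k)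
    simpa using this
  exact le_antisymm ((key _).2 le_rfl) ((key _).1 le_rfl)

/-! #### Dimension -/

/-- The linear map of the block sums of a partition. -/
def blockSum (b : Fin M → Fin n) : (Fin M → ℝ) →ₗ[ℝ] (Fin n → ℝ) where
  toFun v k := ∑ i with b i = k, v i
  map_add' v w := by ext k; simp [sum_add_distrib]
  map_smul' c v := by ext k; simp [mul_sum]

theorem sum_filter_le_eq (b : Fin M → Fin n) (v : Fin M → ℝ) (k : Fin n) :
    ∑ i with b i ≤ k, v i = ∑ l with l ≤ k, blockSum b v l := by
  rw [← sum_fiberwise_of_maps_to (s := {i | b i ≤ k}) (t := {l | l ≤ k}) (g := b)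
    (by simp)]
  refine sum_congr rfl fun l hl =>
    Finset.sum_congr (s₂ := univ.filter fun i => b i = l) ?_ fun _ _ => rfl
  ext i
  simp only [mem_filter, mem_univ, true_and, and_iff_right_iff_imp] at hl ⊢
  exact fun h => h ▸ hl

theorem mem_ker_blockSum_iff (b : Fin M → Fin n) (v : Fin M → ℝ) :
    v ∈ LinearMap.ker (blockSum b) ↔ ∀ k, ∑ i with b i ≤ k, v i = 0 := by
  rw [LinearMap.mem_ker]
  constructor
  · intro h k
    rw [sum_filter_le_eq, h]
    simp
  · intro h
    funext k
    induction k using WellFoundedLT.induction with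
    | ind k ih =>
      have h1 := h k
      rw [sum_filter_le_eq, sum_eq_single k] at h1
      · exact h1
      · intro l hl hlk
        exact ih l (lt_of_le_of_ne (by simpa using hl) hlk)
      · simp

theorem blockSum_surjective {b : Fin M → Fin n} (hb : Function.Surjective b) :
    Function.Surjective (blockSum b) := by
  intro y
  -- One representative of each block carries its whole prescribed sum.
  refine ⟨fun i => if Function.surjInv hb (b i) = i then y (b i) else 0, ?_⟩
  funext k
  change ∑ i with b i = k, _ = _
  rw [sum_eq_single (Function.surjInv hb k)]
  · simp [Function.surjInv_eq hb]
  · intro i hi hne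
    simp only [mem_filter, mem_univ, true_and] at hi
    rw [if_neg]
    rintro h
    exact hne (by rw [← h, hi])
  · simp [Function.surjInv_eq hb]

theorem finrank_ker_blockSum {b : Fin M → Fin n} (hb : Function.Surjective b) :
    Module.finrank ℝ (LinearMap.ker (blockSum b)) = M - n := by
  have h := LinearMap.finrank_range_add_finrank_ker (blockSum b)
  rw [LinearMap.range_eq_top.2 (blockSum_surjective hb), finrank_top] at h
  simp only [Module.finrank_fin_fun] at h
  omega

-- The kernel is cut out by the homogeneous chain equations. From a relatively interior point, a
-- small step along the kernel preserves the finitely many strict constraints, and does not change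
-- the tight ones.
open Filter Topology in
theorem IsStrict.direction_chainFace (hf : IsStrict f) (hM : 1 ≤ M) (b : Fin M → Fin n) :
    (affineSpan ℝ (chainFace f b)).direction = LinearMap.ker (blockSum b) := by
  rw [direction_affineSpan]
  apply le_antisymm
  · rw [vectorSpan_def, Submodule.span_le]
    rintro _ ⟨R, hR, R', hR', rfl⟩
    rw [SetLike.mem_coe, mem_ker_blockSum_iff]
    intro k
    simp [sum_sub_distrib, hR.2 k, hR'.2 k]
  · intro v hv
    rw [mem_ker_blockSum_iff] at hv
    obtain ⟨R, hR, hpos, htight⟩ := hf.exists_mem_chainFace hM b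
    have h1 : ∀ᶠ ε : ℝ in 𝓝[>] 0, ∀ i, 0 < R i + ε * v i := by
      refine eventually_all.2 fun i => ?_
      have : Tendsto (fun ε : ℝ => R i + ε * v i) (𝓝 0) (𝓝 (R i + 0 * v i)) :=
        Continuous.tendsto (by fun_prop) _
      exact nhdsWithin_le_nhds (this.eventually_const_lt (by simpa using hpos i))
    have h2 : ∀ᶠ ε : ℝ in 𝓝[>] 0, ∀ S : Finset (Fin M), ∑ i ∈ S, R i < f S →
        ∑ i ∈ S, R i + ε * ∑ i ∈ S, v i < f S := by
      refine eventually_all.2 fun S => eventually_imp_distrib_left.2 fun hS => ?_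
      have : Tendsto (fun ε : ℝ => ∑ i ∈ S, R i + ε * ∑ i ∈ S, v i) (𝓝 0)
          (𝓝 (∑ i ∈ S, R i + 0 * ∑ i ∈ S, v i)) :=
        Continuous.tendsto (by fun_prop) _
      exact nhdsWithin_le_nhds (this.eventually_lt_const (by simpa using hS))
    obtain ⟨ε, hε1, hε2, hε0⟩ := (h1.and (h2.and self_mem_nhdsWithin)).exists
    have hsum : ∀ S : Finset (Fin M), ∑ i ∈ S, (R + ε • v) i =
        ∑ i ∈ S, R i + ε * ∑ i ∈ S, v i := fun S => by simp [sum_add_distrib, mul_sum]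
    have hmem : R + ε • v ∈ chainFace f b := by
      refine ⟨⟨fun i => (hε1 i).le, fun S => ?_⟩, fun k => ?_⟩
      · rw [hsum]
        rcases (hR.1.2 S).lt_or_eq with h | h
        · exact (hε2 S h).le
        -- The empty set is always tight without belonging to the chain.
        · rcases S.eq_empty_or_nonempty with rfl | hS
          · simp [hf.map_empty]
          · obtain ⟨k, rfl⟩ := htight S hS h
            rw [hv k, h]
            simp
      · rw [hsum, hv k, hR.2 k]
        simp
    have := vsub_mem_vectorSpan ℝ hmem hR
    rw [vsub_eq_sub, add_sub_cancel_left] at this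
    exact (Submodule.smul_mem_iff _ (ne_of_gt hε0)).1 this

theorem IsStrict.hasDim_chainFace (hf : IsStrict f) (hM : 1 ≤ M) {b : Fin M → Fin n}
    (hb : Function.Surjective b) : HasDim (chainFace f b) (M - n) := by
  obtain ⟨R, hR, -⟩ := hf.exists_mem_chainFace hM b
  exact ⟨⟨R, hR⟩, by rw [hf.direction_chainFace hM, finrank_ker_blockSum hb]⟩

/-! #### The faces in the dominant facet -/

theorem sum_mul_layers (b : Fin M → Fin n) (γ : Fin n → ℝ) (R : Fin M → ℝ) :
    ∑ i, R i * ∑ k, (if b i ≤ k then γ k else 0) = ∑ k, γ k * ∑ i with b i ≤ k, R i := by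
  simp only [mul_sum, sum_filter, mul_ite, mul_zero]
  rw [sum_comm]
  simp only [mul_comm]

/-- The supporting inequality is the sum of the constraints of the chain; it is an equality only if
each summand is. -/
theorem isFace_chainFace (f : Finset (Fin M) → ℝ) (b : Fin M → Fin n) :
    IsFace (polytope f) (chainFace f b) := by
  have key := fun R : Fin M → ℝ => sum_mul_layers b (fun _ => 1) R
  simp only [one_mul] at key
  refine ⟨fun i => ∑ k, (if b i ≤ k then 1 else 0), ∑ k, f {i | b i ≤ k}, fun R hR => ?_, ?_⟩
  · rw [key]
    exact sum_le_sum fun k _ => hR.2 _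
  · ext R
    refine and_congr_right fun hR => ?_
    rw [Set.mem_ofPred_eq, key, sum_eq_sum_iff_of_le fun k _ => hR.2 _]
    simp

theorem sum_eq_of_mem_chainFace (hM : 1 ≤ M) {b : Fin M → Fin n} {R : Fin M → ℝ}
    (hR : R ∈ chainFace f b) : ∑ i, R i = f univ := by
  have hn : 0 < n := (b ⟨0, hM⟩).pos
  have h : ({i | b i ≤ ⟨n - 1, by omega⟩} : Finset (Fin M)) = univ := by
    ext i
    simp only [mem_filter, mem_univ, true_and, iff_true, Fin.le_def]
    omega
  simpa [h] using hR.2 ⟨n - 1, by omega⟩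

theorem sum_range_ite_sub (c : ℕ → ℝ) (k n : ℕ) (hk : k ≤ n) :
    ∑ l ∈ range n, (if k ≤ l then c l - c (l + 1) else 0) = c k - c n := by
  induction n, hk using Nat.le_induction with
  | base =>
    rw [sub_self]
    refine sum_eq_zero fun l hl => if_neg ?_
    simpa using hl
  | succ n hk ih => rw [sum_range_succ, ih, if_pos hk]; ring

/-- Every vector is a combination of the indicators of its upper level sets, with positive
coefficients except possibly for the full set. -/
theorem exists_layers (a : Fin M → ℝ) :
    ∃ (n : ℕ) (b : Fin M → Fin n) (γ : Fin n → ℝ), Function.Surjective b ∧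
      (∀ i, a i = ∑ k, if b i ≤ k then γ k else 0) ∧ ∀ k, 0 < γ k ∨ ∀ i, b i ≤ k := by
  classical
  set A : Finset ℝ := univ.image a with hA
  have hmem : ∀ i, a i ∈ A := fun i => mem_image_of_mem a (mem_univ i)
  set e := A.orderIsoOfFin rfl
  -- `c` lists the values of `a` in decreasing order, followed by `0`. The coefficients are the
  -- successive drops; the last one is the least value of `a`, of any sign, and belongs to the full
  -- set.
  set c : ℕ → ℝ := fun l => if h : l < A.card then (e (Fin.rev ⟨l, h⟩) : ℝ) else 0 with hc
  have hcval : ∀ k : Fin A.card, c k = e k.rev := fun k => by simp [hc]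
  refine ⟨A.card, fun i => (e.symm ⟨a i, hmem i⟩).rev, fun k => c k - c (k + 1),
    fun k => ?_, fun i => ?_, fun k => ?_⟩
  · obtain ⟨i, -, hi⟩ := mem_image.1 (e k.rev).2
    refine ⟨i, ?_⟩
    simp [hi]
  · set k := (e.symm ⟨a i, hmem i⟩).rev with hk
    simp only [Fin.le_def]
    rw [Fin.sum_univ_eq_sum_range (fun l => if (k : ℕ) ≤ l then c l - c (l + 1) else 0),
      sum_range_ite_sub c k _ k.2.le, hcval]
    simp [hc, hk]
  · by_cases h : (k : ℕ) + 1 < A.card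
    · left
      change 0 < c k - c (k + 1)
      rw [hcval, sub_pos]
      simp only [hc, h, dif_pos]
      rw [Subtype.coe_lt_coe, e.lt_iff_lt, Fin.rev_lt_rev, Fin.lt_def]
      simp
    · right
      intro i
      rw [Fin.le_def]
      omega

/-- Layers with positive coefficient are bounded by their constraints. The layer of the full set,
whose coefficient may be negative, is constant on `F` because `F` lies in the dominant facet. -/
theorem IsStrict.exists_eq_chainFace (hf : IsStrict f) (hM : 1 ≤ M) {F : Set (Fin M → ℝ)}
    (hF : IsFace (polytope f) F) (hne : F.Nonempty)
    (hdom : ∀ R ∈ F, ∑ i, R i = f univ) :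
    ∃ (n : ℕ) (b : Fin M → Fin n), Function.Surjective b ∧ F = chainFace f b := by
  obtain ⟨a, a₀, hle, rfl⟩ := hF
  obtain ⟨n, b, γ, hb, ha, hγ⟩ := exists_layers a
  have hsum : ∀ R : Fin M → ℝ, ∑ i, R i * a i = ∑ k, γ k * ∑ i with b i ≤ k, R i := fun R => by
    rw [← sum_mul_layers]
    exact sum_congr rfl fun i _ => by rw [ha i]
  have hterm : ∀ R ∈ polytope f, ∑ i, R i = f univ → ∀ k,
      γ k * ∑ i with b i ≤ k, R i ≤ γ k * f {i | b i ≤ k} := by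
    intro R hR hRu k
    rcases hγ k with h | h
    · exact mul_le_mul_of_nonneg_left (hR.2 _) h.le
    · have : ({i | b i ≤ k} : Finset (Fin M)) = univ := by simpa using h
      rw [this, hRu]
  obtain ⟨v, hv, -⟩ := hf.exists_mem_chainFace hM b
  have hval : ∀ R ∈ chainFace f b, ∑ i, R i * a i = ∑ k, γ k * f {i | b i ≤ k} := by
    intro R hR
    rw [hsum]
    exact sum_congr rfl fun k _ => by rw [hR.2 k]
  -- A point of `F` gives `≤`, layer by layer; a point of `chainFace f b`, where all layers are
  -- tight, gives `≥`.
  have ha₀ : a₀ = ∑ k, γ k * f {i | b i ≤ k} := by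
    obtain ⟨R, hR⟩ := hne
    refine le_antisymm ?_ ?_
    · rw [← hR.2, hsum]
      exact sum_le_sum fun k _ => hterm R hR.1 (hdom R hR) k
    · rw [← hval v hv]
      exact hle v hv.1
  refine ⟨n, b, hb, Set.Subset.antisymm (fun R hR => ⟨hR.1, fun k => ?_⟩) fun R hR =>
    ⟨hR.1, (hval R hR).trans ha₀.symm⟩⟩
  have hRu := hdom R hR
  have h : ∑ k, γ k * ∑ i with b i ≤ k, R i = ∑ k, γ k * f {i | b i ≤ k} := by
    rw [← hsum, ← ha₀]
    exact hR.2
  have hk := (sum_eq_sum_iff_of_le fun k _ => hterm R hR.1 hRu k).1 h k (mem_univ k)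
  rcases hγ k with h | h
  · exact mul_left_cancel₀ h.ne' hk
  · have : ({i | b i ≤ k} : Finset (Fin M)) = univ := by simpa using h
    rw [this, hRu]

/-- The faces of dimension `D` in the dominant facet are those of the ordered partitions into
`M - D` blocks. -/
theorem IsStrict.setOf_face_eq_image (hf : IsStrict f) (hM : 1 ≤ M) {D : ℕ} (hD : D ≤ M) :
    {F | IsFace (polytope f) F ∧ (∀ R ∈ F, ∑ i, R i = f univ) ∧ HasDim F D} =
      chainFace f '' {b : Fin M → Fin (M - D) | Function.Surjective b} := by
  ext F
  constructor
  · rintro ⟨hF, hdom, hdim⟩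
    obtain ⟨n, b, hb, rfl⟩ := hf.exists_eq_chainFace hM hF hdim.1 hdom
    have hn : n ≤ M := by simpa using Fintype.card_le_of_surjective b hb
    have h := (hf.hasDim_chainFace hM hb).2.symm.trans hdim.2
    obtain rfl : n = M - D := by omega
    exact ⟨b, hb, rfl⟩
  · rintro ⟨b, hb, rfl⟩
    refine ⟨isFace_chainFace f b, fun R hR => sum_eq_of_mem_chainFace hM hR, ?_⟩
    have := hf.hasDim_chainFace hM hb
    rwa [Nat.sub_sub_self hD] at this

end Polymatroid

/-! ### The region of a multiple-access channel -/

namespace MAC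

variable {M : ℕ} {X : Fin M → Type*} {Y : Type*} [∀ i, Fintype (X i)] [Fintype Y]

/-- The constraints of the region form a strict polymatroid. -/
theorem NonDegenerated.isStrict {P : ∀ i, PMF (X i)} {W : (∀ i, X i) → PMF Y}
    (hR : NonDegenerated P W) : Polymatroid.IsStrict fun S => condInfo P W S Sᶜ := by
  have h : ∀ S : Finset (Fin M),
      condInfo P W S Sᶜ = negCondEntropy P W Finset.univ - negCondEntropy P W Sᶜ := fun S => by
    rw [condInfo_eq_sub, Finset.union_compl]
  refine ⟨by rw [h, Finset.compl_empty, sub_self], fun S T hST hTS => ?_, fun i => ?_⟩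
  · obtain ⟨i, hiS, hiT⟩ := Finset.not_subset.1 hST
    obtain ⟨j, hjT, hjS⟩ := Finset.not_subset.1 hTS
    -- `I(X_{S∖T}; Y | X_{(S∪T)ᶜ}) < I(X_{S∖T}; Y | X_Sᶜ)`, written with `negCondEntropy`, is strict
    -- submodularity after complementation.
    have key := hR.condInfo_lt (Tᶜ \ Sᶜ) (Sᶜ ∩ Tᶜ) Sᶜ ⟨i, by simp [hiS, hiT]⟩
      (Finset.ssubset_univ_iff.2 fun h => by
        have : j ∈ Tᶜ \ Sᶜ := h ▸ Finset.mem_univ j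
        simp [hjT] at this)
      ((Finset.ssubset_iff_of_subset Finset.inter_subset_left).2 ⟨j, by simp [hjS, hjT]⟩)
      (Finset.ssubset_univ_iff.2 fun h => by
        have : i ∈ Sᶜ := h ▸ Finset.mem_univ i
        simp [hiS] at this)
      Finset.sdiff_disjoint
    have e1 : Tᶜ \ Sᶜ ∪ Sᶜ ∩ Tᶜ = Tᶜ := by
      rw [Finset.inter_comm, Finset.sdiff_union_inter]
    have e2 : Tᶜ \ Sᶜ ∪ Sᶜ = (S ∩ T)ᶜ := by
      rw [Finset.sdiff_union_self_eq_union, Finset.compl_inter, Finset.union_comm]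
    rw [condInfo_eq_sub, condInfo_eq_sub, e1, e2, ← Finset.compl_union] at key
    simp only [h]
    linarith
  -- The last increment of `f` is `I(X_i; Y)`.
  · have key := hR.info_pos {i} (Finset.singleton_nonempty i)
    rw [info_eq_sub] at key
    have e : (Finset.univ.erase i)ᶜ = {i} := by
      ext j
      simp
    rw [h, h, e, Finset.compl_univ]
    linarith

end MAC

theorem mainTheorem4 {M : ℕ} (hM : 1 ≤ M) {X : Fin M → Type*} {Y : Type*}
    [∀ i, Fintype (X i)] [Fintype Y]
    (P : ∀ i, PMF (X i)) (W : (∀ i, X i) → PMF Y) (hR : MAC.NonDegenerated P W)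
    (D : ℕ) (hD : D ≤ M) :
    (MAC.dominantFaces P W D).Finite ∧
    ((MAC.dominantFaces P W D).ncard : ℤ) =
      ∑ j ∈ Finset.Icc 1 (M - D), ((M - D).choose j : ℤ) * (-1) ^ (M - D - j) * (j : ℤ) ^ M ∧
    (MAC.dominantFaces P W D).ncard = (M - D).factorial * Nat.stirlingSecond M (M - D) := by
  have hf := hR.isStrict
  have hset : MAC.dominantFaces P W D =
      Polymatroid.chainFace (fun S => MAC.condInfo P W S Sᶜ) ''
        {b : Fin M → Fin (M - D) | Function.Surjective b} := by
    rw [← hf.setOf_face_eq_image hM hD]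
    ext F
    -- `region` is `polytope f` by definition, and a face already lies in it, so only the equation
    -- of the dominant facet matters.
    exact and_congr_right fun ⟨a, a₀, _, hF⟩ => and_congr_left fun _ =>
      ⟨fun h R hRF => (h hRF).2, fun h R hRF => ⟨(hF.le hRF).1, h R hRF⟩⟩
  rw [hset, (hf.chainFace_injOn hM).ncard_image]
  exact ⟨(Set.toFinite _).image _, ncard_surjective_fin hM (M - D)⟩
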